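/- **Setting.** A map $\Phi:\mathbb{R}^m\to\mathbb{R}^d$ is pseudolinear with activation $\phi$ if $\Phi(x)=\phi(Vx-b)$ for some matrix $V\in\mathbb{R}^{d\times m}$ and vector $b\in\mathbb{R}^d$, with $\phi$ applied coordinatewise; here $\phi$ is the threshold function $\phi(t)=\mathbf 1_{\{t>0\}}$ or the ReLU $\phi(t)=\max(0,t)$. Given layer sizes $n_1,\ldots,n_L$ and an activation $\phi_i$ (threshold or ReLU, in any mix) for each $i=1,\ldots,L-1$, let $\mathcal F(n_1,\ldots,n_L)$ be the class of all maps $F=\Phi_{L-1}\circ\cdots\circ\Phi_1:\mathbb{R}^{n_1}\to\mathbb{R}^{n_L}$, where $\Phi_i:\mathbb{R}^{n_i}\to\mathbb{R}^{n_{i+1}}$ is pseudolinear with activation $\phi_i$. Let $\mathcal F(n_1,\ldots,n_L,1)$ be the class of all functions $\Psi\circ G:\mathbb{R}^{n_1}\to\mathbb{R}$ with $G\in\mathcal F(n_1,\ldots,n_L)$ and $\Psi:\mathbb{R}^{n_L}\to\mathbb{R}$ pseudolinear with the threshold activation. **Theorem.** There are absolute constants $C,c>0$ such that the following holds. Let $L\ge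 2$, let $n_1,\ldots,n_L$ be positive integers, put $n_0:=\min(n_2,\ldots,n_L)$, $n_\infty:=\max(n_2,\ldots,n_L)$ and $W:=\sum_{i=3}^{L-1}n_in_{i+1}$ (so $W=0$ if $L\le 3$), and fix any choice of activations $\phi_1,\ldots,\phi_{L-1}$ as above. Let $x_1,\ldots,x_K\in\mathbb{R}^{n_1}$ be unit vectors with $$\|x_i-x_j\|_2\ \ge\ C\sqrt{\frac{\log\log n_\infty}{\log n_0}}\qquad\text{for all } i\ne j,$$ and assume $K\le\exp(c\,n_0^{1/5})$ and $n_\infty\le\exp(c\,n_0^{1/5})$. Let $y_1,\ldots,y_K\in\{0,1\}$ be any labels. 1. If at most $K_1$ of the labels equal $1$ and $W\ge C\,K_1\log^5K$, then there is a map $F\in\mathcal F(n_1,\ldots,n_L)$ such that, for all $k=1,\ldots,K$, $F(x_k)=0$ if and only if $y_k=0$. 2. If $W\ge C\,K\log^5K$, then there is a function $F\in\mathcal F(n_1,\ldots,n_L,1)$ such that $F(x_k)=y_k$ for all $k=1,\ldots,K$. -/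

import Mathlib

/-- The two activation functions, with which the nodes of a layer may be equipped. -/
inductive Activation where
  | threshold
  | relu

/-- `𝟏_{t > 0}` for the threshold activation, `max (0, t)` for ReLU. -/
noncomputable def Activation.fn : Activation → ℝ → ℝ
  | .threshold, t => if 0 < t then 1 else 0
  | .relu, t => max 0 t

/-- `Φ : ℝᵐ → ℝᵈ` is pseudolinear with activation `φ`: `Φ(x) = φ(V x - b)`, where `φ` is applied
to each coordinate, for some weight matrix `V` and some bias vector `b`. -/
def IsPseudolinear (φ : Activation) {m d : ℕ}
    (Φ : EuclideanSpace ℝ (Fin m) → EuclideanSpace ℝ (Fin d)) : Prop :=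
  ∃ (V : Matrix (Fin d) (Fin m) ℝ) (b : Fin d → ℝ),
    ∀ x i, Φ x i = φ.fn ((∑ j, V i j * x j) - b i)

/-- `NetworkMap n act ℓ F`: the feedforward network with layers of `n 1, n 2, …, n ℓ` nodes, in
which the map from layer `i` to layer `i + 1` has the activation `act i`, can compute
`F : ℝ^(n 1) → ℝ^(n ℓ)`. That is, `F = Φ_{ℓ-1} ∘ ⋯ ∘ Φ₁` for some pseudolinear maps
`Φᵢ : ℝ^(n i) → ℝ^(n (i+1))` with activation `act i`. Only the values of `n` on `1, …, ℓ` and of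
`act` on `1, …, ℓ - 1` matter. -/
inductive NetworkMap (n : ℕ → ℕ) (act : ℕ → Activation) :
    (ℓ : ℕ) → (EuclideanSpace ℝ (Fin (n 1)) → EuclideanSpace ℝ (Fin (n ℓ))) → Prop
  | input : NetworkMap n act 1 id
  | layer {ℓ : ℕ} {G : EuclideanSpace ℝ (Fin (n 1)) → EuclideanSpace ℝ (Fin (n ℓ))}
      {Φ : EuclideanSpace ℝ (Fin (n ℓ)) → EuclideanSpace ℝ (Fin (n (ℓ + 1)))} :
      NetworkMap n act ℓ G → IsPseudolinear (act ℓ) Φ → NetworkMap n act (ℓ + 1) (Φ ∘ G)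

/-- The class `𝓕(n₁, …, n_L)` for the activations `act 1, …, act (L - 1)`. -/
def networkClass (n : ℕ → ℕ) (act : ℕ → Activation) (L : ℕ) :
    Set (EuclideanSpace ℝ (Fin (n 1)) → EuclideanSpace ℝ (Fin (n L))) :=
  {F | NetworkMap n act L F}

/-- The class `𝓕(n₁, …, n_L, 1)` of scalar functions: layer `L` is followed by a single output
node, and that node has the threshold activation. -/
def singleOutputClass (n : ℕ → ℕ) (act : ℕ → Activation) (L : ℕ) :
    Set (EuclideanSpace ℝ (Fin (n 1)) → ℝ) :=
  {F | ∃ G ∈ networkClass n act L,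
    ∃ Ψ : EuclideanSpace ℝ (Fin (n L)) → EuclideanSpace ℝ (Fin 1),
      IsPseudolinear Activation.threshold Ψ ∧ ∀ x, F x = Ψ (G x) 0}

/-- `n₀ = min (n₂, …, n_L)`. -/
def minWidth (n : ℕ → ℕ) (L : ℕ) (hL : 2 ≤ L) : ℕ :=
  (Finset.Icc 2 L).inf' (Finset.nonempty_Icc.mpr hL) n

/-- `n_∞ = max (n₂, …, n_L)`. -/
def maxWidth (n : ℕ → ℕ) (L : ℕ) (hL : 2 ≤ L) : ℕ :=
  (Finset.Icc 2 L).sup' (Finset.nonempty_Icc.mpr hL) n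

/-- The number of deep connections `W = n₃ n₄ + ⋯ + n_{L-1} n_L` (an empty sum if `L ≤ 3`). -/
def deepConnections (n : ℕ → ℕ) (L : ℕ) : ℕ :=
  ∑ i ∈ Finset.Ico 3 L, n i * n (i + 1)

open MeasureTheory ProbabilityTheory

/-! Only the zero pattern of each layer on the data matters. Nodes are nonnegative there, so with
either activation a node of the next layer can be made nonzero exactly on any union of the supports
below it, or on the complement of such a union (`Realizes.succ`). What remains is combinatorial:
build the set `Y` of points labelled 1 out of half-spaces with these gates.

Layer 2 is a family of random Gaussian half-spaces at height √(2 log Z), where Z = n₀^(1/5). Each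
data point lies in about a fraction α of them, and separation forces two points to share at most
about αm / log n_∞ of the m half-spaces (`exists_halfspace_code`). A NOR of r random half-spaces
then contains a given point with probability p of order (log K)/N, and two given points with
probability at most e²⁰p²: nearly independent events. Hence, for a set S of at most order N/log K
points, N such NORs suffice for every k ∉ S to lie in one that misses S, and S is exactly the
complement of the union of the NORs missing it (`exists_nor_code`).

So one node of layer ℓ+1 can store order n_ℓ / log K points, and the connections between layers ℓ
and ℓ+1 store order n_ℓ n_{ℓ+1} / log K. Each deep layer also copies the half-space code and keeps
one node accumulating the points stored so far (`Realizes.exists_of_codes`), so the capacities add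
up to order W / log K. -/

/-! ### Chernoff bound with a union bound -/

/-- Exponential moments of independent hit counts, summed over all events. The sign of `θ i` selects
an upper or a lower tail, so both are handled by one sample. -/
theorem exists_sample_forall_count_lt {Ω ι : Type*} [MeasurableSpace Ω] [Fintype ι]
    (μ : Measure Ω) [IsProbabilityMeasure μ] (E : ι → Set Ω) (hE : ∀ i, MeasurableSet (E i))
    (θ b : ι → ℝ) (m : ℕ)
    (h : ∑ i, Real.exp (m * ((Real.exp (θ i) - 1) * μ.real (E i)) - b i) < 1) :
    ∃ ω : Fin m → Ω, ∀ i, θ i * ({l | ω l ∈ E i}.ncard : ℝ) < b i := by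
  classical
  set f : ι → Ω → ℝ := fun i ω ↦ 1 + (E i).indicator (fun _ ↦ Real.exp (θ i) - 1) ω with hf
  have hfint (i) : Integrable (f i) μ :=
    (integrable_const _).add ((integrable_const _).indicator (hE i))
  have hfI (i) : ∫ ω, f i ω ∂μ = 1 + (Real.exp (θ i) - 1) * μ.real (E i) := by
    simp only [hf]
    rw [integral_add (integrable_const _) ((integrable_const _).indicator (hE i)),
      integral_indicator_const _ (hE i)]
    simp [mul_comm]
  have hfe (i) (ω : Fin m → Ω) :
      ∏ l, f i (ω l) = Real.exp (θ i * ({l | ω l ∈ E i}.ncard : ℝ)) := by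
    have h1 : ∀ l, f i (ω l) = Real.exp (if ω l ∈ E i then θ i else 0) := by
      intro l
      by_cases hl : ω l ∈ E i <;> simp [hf, hl]
    simp_rw [h1, ← Real.exp_sum]
    congr 1
    rw [← Finset.sum_filter, Finset.sum_const, nsmul_eq_mul, mul_comm,
      Set.ncard_eq_toFinset_card']
    simp
  have hprod (i) : Integrable (fun ω : Fin m → Ω ↦ ∏ l, f i (ω l)) (Measure.pi fun _ ↦ μ) :=
    Integrable.fintype_prod fun _ ↦ hfint i
  obtain ⟨ω, hω⟩ := exists_le_integral
    (integrable_finsetSum Finset.univ fun i _ ↦ (hprod i).const_mul (Real.exp (-b i)))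
  refine ⟨ω, fun i ↦ ?_⟩
  rw [integral_finsetSum _ fun i _ ↦ (hprod i).const_mul (Real.exp (-b i))] at hω
  have hle : ∀ i, ∫ ω : Fin m → Ω, Real.exp (-b i) * ∏ l, f i (ω l) ∂(Measure.pi fun _ ↦ μ) ≤
      Real.exp (m * ((Real.exp (θ i) - 1) * μ.real (E i)) - b i) := by
    intro i
    rw [integral_const_mul, integral_fintype_prod_eq_pow, hfI, Fintype.card_fin,
      sub_eq_neg_add (_ * _), Real.exp_add, Real.exp_nat_mul]
    have h0 : 0 ≤ 1 + (Real.exp (θ i) - 1) * μ.real (E i) := by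
      have := Real.exp_pos (θ i)
      nlinarith [measureReal_nonneg (μ := μ) (s := E i), measureReal_le_one (μ := μ) (s := E i),
        mul_nonneg this.le (measureReal_nonneg (μ := μ) (s := E i))]
    gcongr
    rw [add_comm]
    exact Real.add_one_le_exp _
  have hlt := hω.trans_lt ((Finset.sum_le_sum fun i _ ↦ hle i).trans_lt h)
  have hi : Real.exp (-b i) * ∏ l, f i (ω l) < 1 := by
    refine lt_of_le_of_lt ?_ hlt
    refine Finset.single_le_sum (f := fun i ↦ Real.exp (-b i) * ∏ l, f i (ω l)) (fun j _ ↦ ?_)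
      (Finset.mem_univ i)
    rw [hfe]
    positivity
  rw [hfe, ← Real.exp_add, Real.exp_lt_one_iff] at hi
  linarith

/-! ### Gaussian tails and pairs of half-spaces -/

/-- The upper tail `P(N > t)` of a standard normal variable. -/
noncomputable def gaussianTail (t : ℝ) : ℝ := (gaussianReal 0 1).real (Set.Ioi t)

theorem gaussianTail_eq_integral (t : ℝ) :
    gaussianTail t = ∫ x in Set.Ioi t, gaussianPDFReal 0 1 x := by
  rw [gaussianTail, measureReal_def, gaussianReal_apply_eq_integral _ one_ne_zero,
    ENNReal.toReal_ofReal]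
  exact integral_nonneg fun x ↦ gaussianPDFReal_nonneg _ _ _

theorem gaussianTail_anti {s t : ℝ} (h : s ≤ t) : gaussianTail t ≤ gaussianTail s :=
  measureReal_mono (Set.Ioi_subset_Ioi h)

/-- Translation by `s` multiplies the density at `x > t` by at most `exp (-(t * s))`. -/
theorem gaussianTail_add_le {t s : ℝ} (hs : 0 ≤ s) :
    gaussianTail (t + s) ≤ Real.exp (-(t * s)) * gaussianTail t := by
  rw [gaussianTail_eq_integral, gaussianTail_eq_integral, ← integral_const_mul,
    ← integral_indicator measurableSet_Ioi, ← integral_indicator measurableSet_Ioi,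
    ← integral_add_right_eq_self _ s]
  have hi := integrable_gaussianPDFReal 0 1
  refine integral_mono ((hi.indicator measurableSet_Ioi).comp_add_right s)
    ((hi.const_mul _).indicator measurableSet_Ioi) fun x ↦ ?_
  by_cases hx : t < x
  · have h1 : t + s < x + s := by linarith
    simp only [Set.indicator, Set.mem_Ioi, hx, h1, if_true, gaussianPDFReal, sub_zero,
      NNReal.coe_one, mul_one]
    rw [mul_left_comm, ← Real.exp_add]
    gcongr
    nlinarith
  · have h1 : ¬ t + s < x + s := by linarith
    simp [Set.indicator, hx, h1]

theorem gaussianTail_le (t : ℝ) (ht : 0 ≤ t) : gaussianTail t ≤ Real.exp (-(t ^ 2 / 2)) := by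
  have h := measure_ge_le_exp_mul_mgf (μ := gaussianReal 0 1) (X := id) t ht
    (integrable_exp_mul_gaussianReal t)
  rw [mgf_id_gaussianReal, ← Real.exp_add] at h
  refine (measureReal_mono fun x hx ↦ ?_).trans (h.trans (le_of_eq ?_))
  · exact (Set.mem_Ioi.1 hx).le
  · congr 1
    push_cast
    ring

theorem le_gaussianTail {t : ℝ} (ht : 0 ≤ t) :
    Real.exp (-((t + 1) ^ 2 / 2)) / 3 ≤ gaussianTail t := by
  rw [gaussianTail_eq_integral]
  have hi := integrable_gaussianPDFReal 0 1
  calc Real.exp (-((t + 1) ^ 2 / 2)) / 3 ≤ gaussianPDFReal 0 1 (t + 1) := by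
        simp only [gaussianPDFReal, sub_zero, NNReal.coe_one, mul_one]
        rw [div_eq_inv_mul]
        have h3 : √(2 * Real.pi) ≤ 3 := by
          rw [Real.sqrt_le_left (by norm_num)]
          nlinarith [Real.pi_lt_four]
        have h0 : 0 < √(2 * Real.pi) := by positivity
        gcongr
        apply le_of_eq
        ring
    _ = ∫ x in Set.Ioc t (t + 1), gaussianPDFReal 0 1 (t + 1) := by simp
    _ ≤ ∫ x in Set.Ioc t (t + 1), gaussianPDFReal 0 1 x := by
        refine setIntegral_mono_on (by simp) hi.integrableOn measurableSet_Ioc fun x hx ↦ ?_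
        simp only [gaussianPDFReal, sub_zero, NNReal.coe_one, mul_one]
        gcongr
        · linarith [hx.1]
        · exact hx.2
    _ ≤ _ := by
        refine setIntegral_mono_set hi.integrableOn ?_ ?_
        · exact Filter.Eventually.of_forall fun x ↦ gaussianPDFReal_nonneg _ _ _
        · exact (Set.Ioc_subset_Ioi_self).eventuallyLE

section

variable {E : Type*} [NormedAddCommGroup E] [InnerProductSpace ℝ E] [FiniteDimensional ℝ E]
  [MeasurableSpace E] [BorelSpace E]

theorem stdGaussian_real_inner_gt (u : E) (hu : ‖u‖ = 1) (t : ℝ) :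
    (stdGaussian E).real {g | t < inner ℝ u g} = gaussianTail t := by
  have h := IsGaussian.map_eq_gaussianReal (μ := stdGaussian E) (innerSL ℝ u)
  rw [integral_strongDual_stdGaussian, variance_dual_stdGaussian, innerSL_apply_norm, hu] at h
  simp only [one_pow, Real.toNNReal_one] at h
  rw [gaussianTail, ← h, map_measureReal_apply (innerSL ℝ u).continuous.measurable
    measurableSet_Ioi]
  rfl

/-- If both inner products exceed `t`, the one with the normalised sum of `u` and `v` exceeds `2t /
‖u + v‖`. By the parallelogram law this is at least `t (1 + ‖u - v‖² / 8)`, so the shift estimate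
applies. -/
theorem stdGaussian_real_inter_inner_gt_le (u v : E) (hu : ‖u‖ = 1) (hv : ‖v‖ = 1) {t : ℝ}
    (ht : 0 ≤ t) :
    (stdGaussian E).real {g | t < inner ℝ u g ∧ t < inner ℝ v g} ≤
      Real.exp (-(t ^ 2 * ‖u - v‖ ^ 2 / 8)) * gaussianTail t := by
  have hpar := parallelogram_law_with_norm ℝ u v
  rw [hu, hv] at hpar
  set δ := ‖u - v‖
  set σ := ‖u + v‖ with hσ
  have hσ0 : 0 ≤ σ := norm_nonneg _
  rcases hσ0.eq_or_lt with h0 | h0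
  · have hv' : v = -u := by
      have : u + v = 0 := norm_eq_zero.1 h0.symm
      exact (neg_eq_of_add_eq_zero_right this).symm
    have : {g : E | t < inner ℝ u g ∧ t < inner ℝ v g} = ∅ := by
      ext g
      simp only [hv', inner_neg_left, Set.mem_ofPred_eq, Set.mem_empty_iff_false, iff_false]
      rintro ⟨h1, h2⟩
      linarith
    rw [this, measureReal_empty]
    exact mul_nonneg (Real.exp_pos _).le measureReal_nonneg
  · have hw : ‖σ⁻¹ • (u + v)‖ = 1 := by
      rw [norm_smul, norm_inv, norm_norm, ← hσ, inv_mul_cancel₀ h0.ne']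
    have hb : 1 + δ ^ 2 / 8 ≤ 2 / σ := by
      rw [le_div_iff₀ h0]
      nlinarith [sq_nonneg (σ - 2), sq_nonneg (σ - 2), mul_nonneg hσ0 (sq_nonneg (σ - 2)),
        mul_nonneg h0.le h0.le]
    calc _ ≤ (stdGaussian E).real {g | t * (2 / σ) < inner ℝ (σ⁻¹ • (u + v)) g} := by
          refine measureReal_mono fun g hg ↦ ?_
          obtain ⟨h1, h2⟩ := hg
          simp only [Set.mem_ofPred_eq, real_inner_smul_left, inner_add_left]
          rw [show t * (2 / σ) = σ⁻¹ * (t + t) by ring]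
          gcongr
      _ = gaussianTail (t * (2 / σ)) := stdGaussian_real_inner_gt _ hw _
      _ ≤ gaussianTail (t + t * (δ ^ 2 / 8)) := by
          apply gaussianTail_anti
          nlinarith
      _ ≤ Real.exp (-(t * (t * (δ ^ 2 / 8)))) * gaussianTail t :=
          gaussianTail_add_le (by positivity)
      _ = _ := by ring_nf

end

/-! ### Zero patterns of layers and monotone or complemented gates -/

theorem Activation.fn_nonneg (φ : Activation) (t : ℝ) : 0 ≤ φ.fn t := by
  cases φ
  · simp only [Activation.fn]; split_ifs <;> norm_num
  · exact le_max_left _ _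

theorem Activation.fn_ne_zero_iff (φ : Activation) (t : ℝ) : φ.fn t ≠ 0 ↔ 0 < t := by
  cases φ
  · simp [Activation.fn]
  · simp [Activation.fn]

/-- The network can compute a map whose nodes in layer `ℓ` are nonnegative on the data, such that
for each `a` some node is nonzero exactly on the data points in `B a`, and such that all other
nodes vanish on the data. -/
def Realizes (n : ℕ → ℕ) (act : ℕ → Activation) {K : ℕ}
    (x : Fin K → EuclideanSpace ℝ (Fin (n 1))) (ℓ : ℕ) {ι : Type*} (B : ι → Set (Fin K)) : Prop :=
  ∃ G, NetworkMap n act ℓ G ∧ ∃ e : ι → Fin (n ℓ), e.Injective ∧ ∀ k,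
    (∀ i, 0 ≤ G (x k) i) ∧ (∀ a, G (x k) (e a) ≠ 0 ↔ k ∈ B a) ∧ ∀ i ∉ Set.range e, G (x k) i = 0

/-- `T` is the union of some of the sets `B a`, or the complement of such a union. -/
def IsGate {ι κ : Type*} (B : ι → Set κ) (T : Set κ) : Prop :=
  ∃ s : Set ι, T = ⋃ a ∈ s, B a ∨ T = (⋃ a ∈ s, B a)ᶜ

section

variable {n : ℕ → ℕ} {act : ℕ → Activation} {K : ℕ} {x : Fin K → EuclideanSpace ℝ (Fin (n 1))}
  {ℓ : ℕ} {ι ι' : Type*}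

theorem NetworkMap.realizes_succ [Fintype ι]
    {G : EuclideanSpace ℝ (Fin (n 1)) → EuclideanSpace ℝ (Fin (n ℓ))} (hG : NetworkMap n act ℓ G)
    {B : ι → Set (Fin K)} (hcard : Fintype.card ι ≤ n (ℓ + 1)) (w : ι → Fin (n ℓ) → ℝ) (b : ι → ℝ)
    (hB : ∀ k a, 0 < (∑ j, w a j * G (x k) j) - b a ↔ k ∈ B a) :
    Realizes n act x (ℓ + 1) B := by
  classical
  obtain ⟨e⟩ : Nonempty (ι ↪ Fin (n (ℓ + 1))) :=
    Function.Embedding.nonempty_of_card_le (by simpa using hcard)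
  set V : Fin (n (ℓ + 1)) → Fin (n ℓ) → ℝ := Function.extend e w 0
  set c : Fin (n (ℓ + 1)) → ℝ := Function.extend e b 0
  set Φ : EuclideanSpace ℝ (Fin (n ℓ)) → EuclideanSpace ℝ (Fin (n (ℓ + 1))) :=
    fun u ↦ WithLp.toLp 2 fun i ↦ (act ℓ).fn ((∑ j, V i j * u j) - c i) with hΦ
  refine ⟨Φ ∘ G, hG.layer ⟨Matrix.of V, c, fun u i ↦ rfl⟩, e, e.injective, fun k ↦
    ⟨fun i ↦ Activation.fn_nonneg _ _, fun a ↦ ?_, fun i hi ↦ ?_⟩⟩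
  · simp only [hΦ, Function.comp_apply, Activation.fn_ne_zero_iff]
    rw [← hB k a]
    simp only [V, c, e.injective.extend_apply]
  · have hV : V i = 0 := Function.extend_apply' _ _ _ fun ⟨a, ha⟩ ↦ hi ⟨a, ha⟩
    have hc : c i = 0 := Function.extend_apply' _ _ _ fun ⟨a, ha⟩ ↦ hi ⟨a, ha⟩
    by_contra h
    simp [hΦ, Activation.fn_ne_zero_iff, hV, hc] at h

/-- A sum of nonnegative values is positive iff one of them is, which yields unions. Complements use
finiteness of the data: the positive sums are bounded away from zero, so one large negative weight
separates them from zero. -/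
theorem Realizes.succ [Fintype ι'] {B : ι → Set (Fin K)} {B' : ι' → Set (Fin K)}
    (h : Realizes n act x ℓ B) (hcard : Fintype.card ι' ≤ n (ℓ + 1))
    (hB' : ∀ a, IsGate B (B' a)) : Realizes n act x (ℓ + 1) B' := by
  classical
  obtain ⟨G, hG, e, -, hGB⟩ := h
  have key : ∀ a, ∃ (w : Fin (n ℓ) → ℝ) (b : ℝ),
      ∀ k, 0 < (∑ j, w j * G (x k) j) - b ↔ k ∈ B' a := by
    intro a
    obtain ⟨s, hs⟩ := hB' a
    set w : Fin (n ℓ) → ℝ := (e '' s).indicator 1 with hw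
    have hw0 (j) : 0 ≤ w j := Set.indicator_nonneg (by simp) j
    have hnn (k) : 0 ≤ ∑ j, w j * G (x k) j :=
      Finset.sum_nonneg fun j _ ↦ mul_nonneg (hw0 j) ((hGB k).1 j)
    have hpos (k) : 0 < ∑ j, w j * G (x k) j ↔ k ∈ ⋃ a ∈ s, B a := by
      rw [(hnn k).lt_iff_ne', Ne, Finset.sum_eq_zero_iff_of_nonneg
        fun j _ ↦ mul_nonneg (hw0 j) ((hGB k).1 j)]
      simp only [Set.mem_iUnion, ← (hGB k).2.1]
      constructor
      · intro h
        push Not at h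
        obtain ⟨j, -, hj⟩ := h
        rw [mul_ne_zero_iff] at hj
        obtain ⟨a, ha, rfl⟩ := Set.mem_of_indicator_ne_zero hj.1
        exact ⟨a, ha, hj.2⟩
      · rintro ⟨a, ha, hne⟩ h
        have := h (e a) (Finset.mem_univ _)
        simp [hw, Set.indicator_of_mem (Set.mem_image_of_mem e ha), hne] at this
    rcases hs with hs | hs
    · exact ⟨w, 0, fun k ↦ by rw [sub_zero, hpos, hs]⟩
    -- `M` dominates the inverse of every positive sum (vanishing sums contribute `0⁻¹ = 0`), so `1
    -- - M * sum` is at most `0` when the sum is positive and equals `1` when it is zero.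
    · set M : ℝ := ∑ k, (∑ j, w j * G (x k) j)⁻¹ with hM
      refine ⟨fun j ↦ -M * w j, -1, fun k ↦ ?_⟩
      simp_rw [mul_assoc, ← Finset.mul_sum]
      rw [hs, Set.mem_compl_iff, ← hpos]
      constructor
      · intro h1 h2
        have : (∑ j, w j * G (x k) j)⁻¹ ≤ M :=
          Finset.single_le_sum (f := fun k ↦ (∑ j, w j * G (x k) j)⁻¹)
            (fun k _ ↦ inv_nonneg.2 (hnn k)) (Finset.mem_univ k)
        have h3 := mul_le_mul_of_nonneg_right this h2.le
        rw [inv_mul_cancel₀ h2.ne'] at h3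
        linarith
      · intro h1
        have : ∑ j, w j * G (x k) j = 0 := le_antisymm (not_lt.1 h1) (hnn k)
        rw [this]
        norm_num
  choose w b hwb using key
  exact hG.realizes_succ hcard w b fun k a ↦ hwb a k

theorem realizes_two [Fintype ι] (hcard : Fintype.card ι ≤ n 2)
    (g : ι → EuclideanSpace ℝ (Fin (n 1))) (t : ι → ℝ) :
    Realizes n act x 2 fun a ↦ {k | t a < inner ℝ (x k) (g a)} := by
  refine NetworkMap.input.realizes_succ hcard (fun a j ↦ g a j) t fun k a ↦ ?_
  rw [sub_pos, Set.mem_ofPred_eq, PiLp.inner_apply]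
  simp

theorem IsGate.self {κ : Type*} (B : ι → Set κ) (a : ι) : IsGate B (B a) :=
  ⟨{a}, Or.inl (by simp)⟩

theorem IsGate.empty {κ : Type*} (B : ι → Set κ) : IsGate B ∅ :=
  ⟨∅, Or.inl (by simp)⟩

theorem IsGate.univ {κ : Type*} (B : ι → Set κ) : IsGate B Set.univ :=
  ⟨∅, Or.inr (by simp)⟩

theorem IsGate.comp {κ : Type*} {B : ι → Set κ} {B' : ι' → Set κ} {T : Set κ} (h : IsGate B T)
    (f : ι → ι') (hf : ∀ a, B' (f a) = B a) : IsGate B' T := by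
  obtain ⟨s, hs⟩ := h
  refine ⟨f '' s, ?_⟩
  simpa [Set.biUnion_image, hf] using hs

theorem Realizes.exists_mem_networkClass {B : ι → Set (Fin K)} (h : Realizes n act x ℓ B) :
    ∃ F ∈ networkClass n act ℓ, ∀ k, (∀ i, 0 ≤ F (x k) i) ∧ (F (x k) = 0 ↔ ∀ a, k ∉ B a) := by
  obtain ⟨G, hG, e, -, hGB⟩ := h
  refine ⟨G, hG, fun k ↦ ⟨(hGB k).1, ?_, ?_⟩⟩
  · intro h0 a ha
    exact ((hGB k).2.1 a).2 ha (by simp [h0])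
  · intro h0
    ext i
    by_cases hi : i ∈ Set.range e
    · obtain ⟨a, rfl⟩ := hi
      by_contra hne
      exact h0 a (((hGB k).2.1 a).1 hne)
    · exact (hGB k).2.2 i hi

end

theorem exists_mem_singleOutputClass {n : ℕ → ℕ} {act : ℕ → Activation} {K L : ℕ}
    {x : Fin K → EuclideanSpace ℝ (Fin (n 1))} {y : Fin K → ℝ} (hy : ∀ k, y k = 0 ∨ y k = 1)
    {G : EuclideanSpace ℝ (Fin (n 1)) → EuclideanSpace ℝ (Fin (n L))}
    (hG : G ∈ networkClass n act L) (hpos : ∀ k i, 0 ≤ G (x k) i)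
    (hGy : ∀ k, G (x k) = 0 ↔ y k = 0) :
    ∃ F ∈ singleOutputClass n act L, ∀ k, F (x k) = y k := by
  set Ψ : EuclideanSpace ℝ (Fin (n L)) → EuclideanSpace ℝ (Fin 1) :=
    fun u ↦ WithLp.toLp 2 fun _ ↦ Activation.threshold.fn ((∑ j, 1 * u j) - 0) with hΨ
  refine ⟨fun z ↦ Ψ (G z) 0, ⟨G, hG, Ψ, ⟨Matrix.of fun _ _ ↦ 1, fun _ ↦ 0, fun u i ↦ rfl⟩,
    fun _ ↦ rfl⟩, fun k ↦ ?_⟩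
  have hnn : 0 ≤ ∑ j, G (x k) j := Finset.sum_nonneg fun j _ ↦ hpos k j
  have h0 : ∑ j, G (x k) j = 0 ↔ G (x k) = 0 := by
    rw [Finset.sum_eq_zero_iff_of_nonneg fun j _ ↦ hpos k j]
    exact ⟨fun h ↦ by ext i; exact h i (Finset.mem_univ _), fun h i _ ↦ by simp [h]⟩
  simp only [hΨ, Activation.fn, one_mul, sub_zero, hnn.lt_iff_ne', Ne, h0, hGy]
  rcases hy k with h | h <;> simp [h]

/-! ### The random half-space code of layer 2 -/

theorem exists_halfspace_code {E : Type*} [NormedAddCommGroup E] [InnerProductSpace ℝ E]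
    [FiniteDimensional ℝ E] [MeasurableSpace E] [BorelSpace E] {K m : ℕ} (hK : 2 ≤ K)
    (x : Fin K → E) (hx : ∀ k, ‖x k‖ = 1) {t η : ℝ} (ht : 0 ≤ t) (hη : 0 < η) (hη1 : η ≤ 1)
    (hsep : ∀ j k, j ≠ k → Real.exp (-(t ^ 2 * ‖x j - x k‖ ^ 2 / 8)) ≤ η / 4)
    (hm : 12 * Real.log K < gaussianTail t * m * η ^ 2) :
    ∃ g : Fin m → E,
      (∀ k, |({l | t < inner ℝ (x k) (g l)}.ncard : ℝ) - gaussianTail t * m| ≤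
        η * (gaussianTail t * m)) ∧
      ∀ j k, j ≠ k → ({l | t < inner ℝ (x j) (g l) ∧ t < inner ℝ (x k) (g l)}.ncard : ℝ) ≤
        η * (gaussianTail t * m) := by
  classical
  set α := gaussianTail t with hα
  have hα0 : 0 ≤ α := measureReal_nonneg
  have hαm : 0 ≤ α * m := by positivity
  set ev : Bool × Fin K × Fin K → Set E :=
    fun p ↦ {g | t < inner ℝ (x p.2.1) g ∧ t < inner ℝ (x p.2.2) g} with hev
  -- Diagonal pairs encode single points, and the Boolean chooses the upper or lower tail;
  -- off-diagonal pairs need only an upper tail. With `θ = ±η/2` the margin `η²/2` becomes relative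
  -- error `η`, and `e^θ - 1 ≤ θ + θ²` leaves exponent `-αmη²/4`.
  set θ : Bool × Fin K × Fin K → ℝ :=
    fun p ↦ if p.2.1 = p.2.2 then (if p.1 then η / 2 else -(η / 2)) else 1 with hθ
  set b : Bool × Fin K × Fin K → ℝ :=
    fun p ↦ if p.2.1 = p.2.2 then θ p * (α * m) + η ^ 2 / 2 * (α * m) else η * (α * m) with hb
  have hmeas (p) : MeasurableSet (ev p) := by
    apply IsOpen.measurableSet
    have (y : E) : IsOpen {g : E | t < inner ℝ y g} := isOpen_lt continuous_const (by fun_prop)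
    exact (this _).inter (this _)
  have hK0 : (0 : ℝ) < K := by positivity
  have hterm (p) : Real.exp (m * ((Real.exp (θ p) - 1) * (stdGaussian E).real (ev p)) - b p) <
      ((K : ℝ) ^ 3)⁻¹ := by
    have h3 : ((K : ℝ) ^ 3)⁻¹ = Real.exp (-(3 * Real.log K)) := by
      rw [Real.exp_neg, ← Real.exp_log (pow_pos hK0 3), Real.log_pow]
      norm_num
    rw [h3, Real.exp_lt_exp]
    suffices h : m * ((Real.exp (θ p) - 1) * (stdGaussian E).real (ev p)) - b p ≤
        -(α * m * η ^ 2 / 4) by linarith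
    obtain ⟨c, j, k⟩ := p
    by_cases hjk : j = k
    · subst hjk
      have hP : (stdGaussian E).real (ev (c, j, j)) = α := by
        simp only [hev, and_self]
        exact stdGaussian_real_inner_gt _ (hx j) t
      have hθ2 : θ (c, j, j) ^ 2 = η ^ 2 / 4 := by
        cases c <;> simp [hθ] <;> ring
      have habs : |θ (c, j, j)| ≤ 1 := by
        rw [← sq_le_one_iff_abs_le_one, hθ2]
        nlinarith
      have hexp := (abs_le.1 (Real.abs_exp_sub_one_sub_id_le habs)).2
      rw [hθ2] at hexp
      have hb' : b (c, j, j) = θ (c, j, j) * (α * m) + η ^ 2 / 2 * (α * m) := by simp [hb]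
      rw [hP, hb']
      nlinarith
    · have hP : (stdGaussian E).real (ev (c, j, k)) ≤ η / 4 * α :=
        (stdGaussian_real_inter_inner_gt_le _ _ (hx j) (hx k) ht).trans
          (mul_le_mul_of_nonneg_right (hsep j k hjk) hα0)
      have hb' : b (c, j, k) = η * (α * m) := by simp [hb, hjk]
      have hθ' : θ (c, j, k) = 1 := by simp [hθ, hjk]
      rw [hb', hθ']
      have he : Real.exp 1 - 1 ≤ 2 := by linarith [Real.exp_one_lt_d9]
      have he0 : 0 ≤ Real.exp 1 - 1 := by linarith [Real.exp_one_gt_d9]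
      have h1 : (Real.exp 1 - 1) * (stdGaussian E).real (ev (c, j, k)) ≤ 2 * (η / 4 * α) := by
        gcongr
      have h2 := mul_le_mul_of_nonneg_left h1 (Nat.cast_nonneg (α := ℝ) m)
      nlinarith [mul_nonneg hαm (mul_nonneg hη.le (sub_nonneg.2 hη1)), mul_nonneg hαm hη.le]
  obtain ⟨g, hg⟩ := exists_sample_forall_count_lt (stdGaussian E) ev hmeas θ b m (by
    have hne : (Finset.univ : Finset (Bool × Fin K × Fin K)).Nonempty :=
      ⟨(true, ⟨0, by omega⟩, ⟨0, by omega⟩), Finset.mem_univ _⟩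
    refine (Finset.sum_lt_sum_of_nonempty hne fun p _ ↦ hterm p).trans_le ?_
    rw [Finset.sum_const, Finset.card_univ, nsmul_eq_mul, mul_inv_le_iff₀ (by positivity), one_mul]
    simp only [Fintype.card_prod, Fintype.card_bool, Fintype.card_fin]
    norm_cast
    nlinarith [Nat.mul_le_mul_right (K * K) hK])
  refine ⟨g, fun k ↦ ?_, fun j k hjk ↦ ?_⟩
  · have h1 := hg (true, k, k)
    have h2 := hg (false, k, k)
    simp only [hev, hθ, hb, and_self, if_true, Set.mem_ofPred_eq, Bool.false_eq_true,
      if_false] at h1 h2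
    rw [abs_le]
    constructor <;> nlinarith
  · have h1 := hg (true, j, k)
    simp only [hev, hθ, hb, hjk, if_false, Set.mem_ofPred_eq, one_mul] at h1
    exact h1.le

/-! ### Random NOR gates and storage of small sets -/

theorem uniformOn_univ_real {m : ℕ} (s : Set (Fin m)) :
    (uniformOn (Set.univ : Set (Fin m))).real s = s.ncard / m := by
  classical
  rw [measureReal_def, uniformOn_univ, Measure.count_apply (Set.toFinite s).measurableSet,
    ENNReal.toReal_div, Fintype.card_fin, ENNReal.toReal_natCast, Set.encard_eq_coe_toFinset_card,
    Set.ncard_eq_toFinset_card']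
  simp

theorem pi_uniformOn_real_forall_mem {m : ℕ} [NeZero m] (r : ℕ) (s : Set (Fin m)) :
    (Measure.pi fun _ : Fin r ↦ uniformOn (Set.univ : Set (Fin m))).real {T | ∀ l, T l ∈ s} =
      (s.ncard / m : ℝ) ^ r := by
  have : {T : Fin r → Fin m | ∀ l, T l ∈ s} = Set.univ.pi fun _ ↦ s := by
    ext T; simp
  rw [this, measureReal_def, Measure.pi_pi, ENNReal.toReal_prod, ← measureReal_def,
    uniformOn_univ_real]
  simp [div_pow]

-- Taking NORs turns small pairwise overlap into near independence of rare events. A union bound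
-- over the points of `S j` shows that a random NOR contains a given `k ∉ S j` and misses `S j` with
-- probability at least `p/2`; Chernoff then supplies such a NOR for all pairs `(j, k)` at once.
set_option maxHeartbeats 800000 in
theorem exists_nor_code {K m : ℕ} (hK : 2 ≤ K) (hm : 0 < m) (A : Fin m → Set (Fin K)) {α η : ℝ}
    (hα : 0 < α) (hα4 : α ≤ 1 / 4) (hη : 0 < η) (hη1 : η ≤ 1)
    (hcount : ∀ k, |({l | k ∈ A l}.ncard : ℝ) - α * m| ≤ η * (α * m))
    (hpair : ∀ j k, j ≠ k → ({l | j ∈ A l ∧ k ∈ A l}.ncard : ℝ) ≤ η * (α * m))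
    {N : ℕ} (hN : 12 * Real.log K ≤ N) (hNη : η * Real.log N ≤ 1)
    {J : Type*} [Fintype J] (hJ : Fintype.card J ≤ K) (S : J → Set (Fin K))
    (hS : ∀ j, 48 * Real.exp 20 * Real.log K * (S j).ncard ≤ N) :
    ∃ b : Fin N → Set (Fin K), (∀ i, IsGate A (b i)) ∧ ∀ j, IsGate b (S j) := by
  classical
  have : NeZero m := ⟨hm.ne'⟩
  have hm0 : (0 : ℝ) < m := by positivity
  have hK0 : (0 : ℝ) < K := by positivity
  have hlog : 0.6931471803 < Real.log K :=
    Real.log_two_gt_d9.trans_le (Real.log_le_log (by norm_num) (by exact_mod_cast hK))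
  set X := 12 * Real.log K with hX
  have hX1 : 1 ≤ X := by linarith
  have hN0 : (0 : ℝ) < N := by linarith
  set q := 1 - α * (1 + η) with hq
  have hαη : α * η ≤ α := by nlinarith
  have hαη0 : 0 < α * η := by positivity
  have hq2 : 1 / 2 ≤ q := by rw [hq]; nlinarith
  have hq1 : q < 1 := by rw [hq]; nlinarith
  -- The fan-in `r` is the last exponent with `q ^ r ≥ X / N`; as `q ≥ 1/2`, this fixes `p = q ^ r`
  -- between `X / N` and `2X / N`.
  obtain ⟨r, hr1, hr2⟩ := exists_nat_pow_near_of_lt_one (div_pos (by linarith : 0 < X) hN0)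
    ((div_le_one hN0).2 hN) (by linarith) hq1
  set p := q ^ r with hp
  have hp0 : 0 < p := by positivity
  have hpX : p * N ≤ 2 * X := by
    rw [pow_succ, lt_div_iff₀ hN0] at hr1
    nlinarith [mul_pos hp0 hN0]
  have hXp : X ≤ p * N := (div_le_iff₀ hN0).1 hr2
  -- Since `p ≥ 1/N`, the fan-in satisfies `rα(1 + η) ≤ log N`; overlap at most `1 / log N`
  -- therefore keeps the error accumulated over `r` draws bounded.
  have hrα : r * α * η ≤ 1 := by
    have h1 : p ≤ Real.exp (-(r * (α * (1 + η)))) := by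
      rw [hp, ← mul_neg, Real.exp_nat_mul]
      gcongr
      linarith [Real.add_one_le_exp (-(α * (1 + η)))]
    have h2 : Real.exp (r * (α * (1 + η))) ≤ N := by
      rw [Real.exp_neg] at h1
      have := mul_le_mul_of_nonneg_right h1 hN0.le
      rw [inv_mul_eq_div] at this
      have h3 := (hX1.trans hXp).trans this
      rwa [le_div_iff₀ (Real.exp_pos _), one_mul] at h3
    rw [← Real.le_log_iff_exp_le hN0] at h2
    have h3 := mul_le_mul_of_nonneg_left h2 hη.le
    have h4 : 0 ≤ (r : ℝ) * α * η * η := by positivity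
    nlinarith
  set μ := Measure.pi fun _ : Fin r ↦ uniformOn (Set.univ : Set (Fin m)) with hμ
  set nor : (Fin r → Fin m) → Set (Fin K) := fun T ↦ {k | ∀ l, k ∉ A (T l)} with hnor
  have hfire (k) : p ≤ μ.real {T | k ∈ nor T} := by
    have h1 := pi_uniformOn_real_forall_mem r ({l | k ∈ A l}ᶜ)
    have h2 : {T | k ∈ nor T} = {T : Fin r → Fin m | ∀ l, T l ∈ {l | k ∈ A l}ᶜ} := rfl
    have h3 := Set.ncard_add_ncard_compl {l | k ∈ A l}
    rw [Nat.card_eq_fintype_card, Fintype.card_fin] at h3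
    have h4 : ({l | k ∈ A l}.ncard : ℝ) + ({l | k ∈ A l}ᶜ.ncard : ℝ) = m := by exact_mod_cast h3
    rw [h2, h1, hp]
    refine pow_le_pow_left₀ (by linarith) ?_ r
    rw [le_div_iff₀ hm0, hq]
    linarith [(abs_le.1 (hcount k)).2]
  have hboth (j k) (hjk : j ≠ k) : μ.real {T | j ∈ nor T ∧ k ∈ nor T} ≤ p ^ 2 * Real.exp 20 := by
    have h1 := pi_uniformOn_real_forall_mem r (({l | j ∈ A l} ∪ {l | k ∈ A l})ᶜ)
    have h2 : {T | j ∈ nor T ∧ k ∈ nor T} =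
        {T : Fin r → Fin m | ∀ l, T l ∈ ({l | j ∈ A l} ∪ {l | k ∈ A l})ᶜ} := by
      ext T
      simp [hnor, forall_and]
    have h3 := Set.ncard_add_ncard_compl ({l | j ∈ A l} ∪ {l | k ∈ A l})
    rw [Nat.card_eq_fintype_card, Fintype.card_fin] at h3
    have h5 := Set.ncard_union_add_ncard_inter {l | j ∈ A l} {l | k ∈ A l}
    have h4 : (({l | j ∈ A l} ∪ {l | k ∈ A l}).ncard : ℝ) +
      (({l | j ∈ A l} ∪ {l | k ∈ A l})ᶜ.ncard : ℝ) = m := by exact_mod_cast h3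
    have h6 : (({l | j ∈ A l} ∪ {l | k ∈ A l}).ncard : ℝ) +
        (({l | j ∈ A l} ∩ {l | k ∈ A l}).ncard : ℝ) =
        ({l | j ∈ A l}.ncard : ℝ) + ({l | k ∈ A l}.ncard : ℝ) := by exact_mod_cast h5
    have h7 : (({l | j ∈ A l} ∩ {l | k ∈ A l}).ncard : ℝ) ≤ η * (α * m) := hpair j k hjk
    rw [h2, h1]
    -- Inclusion–exclusion loses `3αη` and comparison with `q²` another `2αη`; since `q² ≥ 1/4`, the
    -- total `5αη` is at most `20αη q²`, whence the constant 20.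
    have h8 : ((({l | j ∈ A l} ∪ {l | k ∈ A l})ᶜ.ncard : ℝ) / m) ≤
        q ^ 2 * Real.exp (20 * (α * η)) := by
      have h9 : ((({l | j ∈ A l} ∪ {l | k ∈ A l})ᶜ.ncard : ℝ) / m) ≤ 1 - 2 * α + 3 * (α * η) := by
        rw [div_le_iff₀ hm0]
        linarith [(abs_le.1 (hcount j)).1, (abs_le.1 (hcount k)).1]
      have h10 : 1 - 2 * α - 2 * (α * η) ≤ q ^ 2 := by
        rw [hq]
        linarith [sq_nonneg (α * (1 + η)), (by ring : (1 - α * (1 + η)) ^ 2 =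
          1 - 2 * α - 2 * (α * η) + (α * (1 + η)) ^ 2)]
      have h11 : (1 / 2) ^ 2 ≤ q ^ 2 := by gcongr
      have h12 : 20 * (α * η) + 1 ≤ Real.exp (20 * (α * η)) := Real.add_one_le_exp _
      have h13 := mul_le_mul_of_nonneg_left h12 (sq_nonneg q)
      have h14 := mul_le_mul_of_nonneg_right h11 hαη0.le
      linarith
    calc _ ≤ (q ^ 2 * Real.exp (20 * (α * η))) ^ r := by gcongr
      _ = p ^ 2 * Real.exp (20 * (r * α * η)) := by
        rw [mul_pow, ← Real.exp_nat_mul, hp, ← pow_mul, ← pow_mul, mul_comm 2 r]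
        ring_nf
      _ ≤ _ := by
        gcongr
        linarith
  set ev : {z : J × Fin K // z.2 ∉ S z.1} → Set (Fin r → Fin m) :=
    fun z ↦ {T | z.1.2 ∈ nor T ∧ ∀ s ∈ S z.1.1, s ∉ nor T} with hev
  have hevP (z) : p / 2 ≤ μ.real (ev z) := by
    obtain ⟨⟨j, k⟩, hk⟩ := z
    have hsub : {T | k ∈ nor T} ⊆ ev ⟨(j, k), hk⟩ ∪
        ⋃ s ∈ (S j).toFinset, {T | k ∈ nor T ∧ s ∈ nor T} := by
      intro T hT
      by_cases h : ∀ s ∈ S j, s ∉ nor T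
      · exact Or.inl ⟨hT, h⟩
      · push Not at h
        obtain ⟨s, hs, hsT⟩ := h
        refine Or.inr ?_
        simp only [Set.mem_iUnion, Set.mem_toFinset]
        exact ⟨s, hs, hT, hsT⟩
    have h1 := (hfire k).trans ((measureReal_mono hsub).trans (measureReal_union_le _ _))
    have h2 : μ.real (⋃ s ∈ (S j).toFinset, {T | k ∈ nor T ∧ s ∈ nor T}) ≤
        (S j).ncard * (p ^ 2 * Real.exp 20) := by
      refine (measureReal_biUnion_finset_le _ _).trans ?_
      rw [Set.ncard_eq_toFinset_card', ← nsmul_eq_mul]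
      refine Finset.sum_le_card_nsmul _ _ _ fun s hs ↦ hboth k s ?_
      rintro rfl
      exact hk (Set.mem_toFinset.1 hs)
    have h3 : (S j).ncard * (p ^ 2 * Real.exp 20) ≤ p / 2 := by
      have h4 := hS j
      have h5 : (0 : ℝ) ≤ (S j).ncard * Real.exp 20 := by positivity
      have h6 : 2 * ((S j).ncard * Real.exp 20) * p * N ≤ 1 * N := by
        calc _ = 2 * ((S j).ncard * Real.exp 20) * (p * N) := by ring
          _ ≤ 2 * ((S j).ncard * Real.exp 20) * (2 * X) := by gcongr
          _ = 48 * Real.exp 20 * Real.log K * (S j).ncard := by rw [hX]; ring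
          _ ≤ _ := by linarith
      have h7 := le_of_mul_le_mul_right h6 hN0
      nlinarith
    linarith
  -- With `θ = -1` and `b = 0` the conclusion says that every event occurs at least once.
  obtain ⟨T, hT⟩ := exists_sample_forall_count_lt μ ev (fun z ↦ (Set.toFinite _).measurableSet)
    (fun _ ↦ -1) (fun _ ↦ 0) N (by
      have hterm (z) : Real.exp (N * ((Real.exp (-1) - 1) * μ.real (ev z)) - 0) ≤
          ((K : ℝ) ^ 3)⁻¹ := by
        have h3 : ((K : ℝ) ^ 3)⁻¹ = Real.exp (-(3 * Real.log K)) := by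
          rw [Real.exp_neg, ← Real.exp_log (pow_pos hK0 3), Real.log_pow]
          norm_num
        rw [h3, Real.exp_le_exp]
        have he : Real.exp (-1) ≤ 1 / 2 := by
          rw [Real.exp_neg, one_div]
          gcongr
          linarith [Real.exp_one_gt_d9]
        have h4 : (1 / 2) * (p / 2) ≤ (1 - Real.exp (-1)) * μ.real (ev z) :=
          mul_le_mul (by linarith) (hevP z) (by linarith) (by linarith)
        have h5 := mul_le_mul_of_nonneg_left h4 hN0.le
        nlinarith
      refine (Finset.sum_le_sum fun z _ ↦ hterm z).trans_lt ?_
      rw [Finset.sum_const, Finset.card_univ, nsmul_eq_mul, mul_inv_lt_iff₀ (by positivity),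
        one_mul]
      have h1 : Fintype.card {z : J × Fin K // z.2 ∉ S z.1} ≤ K * K := by
        refine (Fintype.card_subtype_le _).trans ?_
        rw [Fintype.card_prod, Fintype.card_fin]
        gcongr
      have h2 : K * K < K ^ 3 := by
        nlinarith [Nat.mul_le_mul_right (K * K) hK, Nat.mul_le_mul hK hK]
      exact_mod_cast h1.trans_lt h2)
  refine ⟨fun i ↦ nor (T i), fun i ↦ ⟨Set.range (T i), Or.inr ?_⟩,
    fun j ↦ ⟨{i | ∀ s ∈ S j, s ∉ nor (T i)}, Or.inr ?_⟩⟩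
  · ext k
    simp [hnor]
  · ext k
    simp only [Set.mem_compl_iff, Set.mem_iUnion, not_exists, Set.mem_ofPred_eq]
    constructor
    · intro hk i hi hkT
      exact hi k hk hkT
    · intro h
      by_contra hk
      have h1 := hT ⟨(j, k), hk⟩
      have h2 : {l | T l ∈ ev ⟨(j, k), hk⟩}.ncard ≠ 0 := by
        rintro h0
        simp [h0] at h1
      obtain ⟨i, hi⟩ := Set.nonempty_of_ncard_ne_zero h2
      exact h i hi.2 hi.1

/-- A layer may have far more than `K` groups, but disjointness leaves at most `K` nonempty ones,
and the empty set is always a gate. -/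
theorem exists_nor_code_of_disjoint {K m : ℕ} (hK : 2 ≤ K) (hm : 0 < m) (A : Fin m → Set (Fin K))
    {α η : ℝ} (hα : 0 < α) (hα4 : α ≤ 1 / 4) (hη : 0 < η) (hη1 : η ≤ 1)
    (hcount : ∀ k, |({l | k ∈ A l}.ncard : ℝ) - α * m| ≤ η * (α * m))
    (hpair : ∀ j k, j ≠ k → ({l | j ∈ A l ∧ k ∈ A l}.ncard : ℝ) ≤ η * (α * m))
    {N : ℕ} (hN : 12 * Real.log K ≤ N) (hNη : η * Real.log N ≤ 1)
    {J : Type*} [Fintype J] (S : J → Set (Fin K)) (hdisj : Pairwise fun i j ↦ Disjoint (S i) (S j))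
    (hS : ∀ j, 48 * Real.exp 20 * Real.log K * (S j).ncard ≤ N) :
    ∃ b : Fin N → Set (Fin K), (∀ i, IsGate A (b i)) ∧ ∀ j, IsGate b (S j) := by
  classical
  have hJ : Fintype.card {j // (S j).Nonempty} ≤ K := by
    refine (Fintype.card_le_of_injective (fun j ↦ j.2.some) fun i j hij ↦ ?_).trans_eq
      (Fintype.card_fin K)
    by_contra hne
    have hi := i.2.some_mem
    have hj := j.2.some_mem
    simp only at hij
    rw [← hij] at hj
    exact Set.disjoint_left.1 (hdisj fun h ↦ hne (Subtype.ext h)) hi hj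
  obtain ⟨b, hb, hbS⟩ := exists_nor_code hK hm A hα hα4 hη hη1 hcount hpair hN hNη hJ
    (fun j ↦ S j.1) (fun j ↦ hS j.1)
  refine ⟨b, hb, fun j ↦ ?_⟩
  rcases (S j).eq_empty_or_nonempty with h | h
  · rw [h]
    exact IsGate.empty b
  · exact hbS ⟨j, h⟩

/-! ### Distributing the points over the layers and assembling the network -/

/-- `Y` is injected into slots (layer, node, position). Points in the slots of layer `ℓ` form groups
at `ℓ + 1`, where the code of layer `ℓ` is decoded; hence layer 3 has only empty groups. -/
theorem exists_groups {κ : Type*} [Finite κ] (Y : Set κ) (L : ℕ) (q s : ℕ → ℕ)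
    (h : Y.ncard ≤ ∑ ℓ ∈ Finset.Ico 3 L, q (ℓ + 1) * s ℓ) :
    ∃ P : (ℓ : ℕ) → Fin (q ℓ) → Set κ, (∀ j, P 3 j = ∅) ∧
      (∀ ℓ j, (P (ℓ + 1) j).ncard ≤ s ℓ) ∧
      (∀ ℓ, Pairwise fun i j ↦ Disjoint (P ℓ i) (P ℓ j)) ∧
      ∀ k, k ∈ Y ↔ ∃ ℓ, 3 ≤ ℓ ∧ ℓ ≤ L ∧ ∃ j, k ∈ P ℓ j := by
  classical
  have := Fintype.ofFinite κ
  set T : Finset (Σ _ : ℕ, ℕ × ℕ) :=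
    (Finset.Ico 3 L).sigma fun ℓ ↦ Finset.range (q (ℓ + 1)) ×ˢ Finset.range (s ℓ) with hT
  have hcard : Fintype.card Y ≤ Fintype.card T := by
    rw [← Nat.card_eq_fintype_card, Nat.card_coe_set_eq, Fintype.card_coe, hT, Finset.card_sigma]
    simpa using h
  obtain ⟨g⟩ := Function.Embedding.nonempty_of_card_le hcard
  set f : κ → Σ _ : ℕ, ℕ × ℕ := fun k ↦ if hk : k ∈ Y then (g ⟨k, hk⟩).1 else ⟨0, 0, 0⟩ with hf
  have hfT (k) (hk : k ∈ Y) : f k ∈ T := by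
    simp only [hf, dif_pos hk]
    exact (g _).2
  have hinj : Set.InjOn f Y := by
    intro k hk k' hk' h
    simp only [hf, dif_pos hk, dif_pos hk'] at h
    exact congrArg Subtype.val (g.injective (Subtype.ext h))
  simp only [hT, Finset.mem_sigma, Finset.mem_Ico, Finset.mem_product, Finset.mem_range] at hfT
  refine ⟨fun ℓ j ↦ {k | k ∈ Y ∧ (f k).1 + 1 = ℓ ∧ (f k).2.1 = j}, fun j ↦ ?_, fun ℓ j ↦ ?_,
    fun ℓ i j hij ↦ ?_, fun k ↦ ⟨fun hk ↦ ?_, ?_⟩⟩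
  · ext k
    simp only [Set.mem_ofPred_eq, Set.mem_empty_iff_false, iff_false]
    rintro ⟨hk, h1, -⟩
    have := (hfT k hk).1.1
    omega
  · rw [← Finset.card_range (s ℓ), ← Set.ncard_coe_finset]
    refine Set.ncard_le_ncard_of_injOn (fun k ↦ (f k).2.2) ?_ ?_ (Finset.finite_toSet _)
    · rintro k ⟨hk, h1, h2⟩
      have h3 := (hfT k hk).2.2
      rw [show (f k).1 = ℓ by omega] at h3
      simpa using h3
    · rintro k ⟨hk, h1, h2⟩ k' ⟨hk', h1', h2'⟩ h3
      refine hinj hk hk' (Sigma.ext (by omega) (heq_of_eq (Prod.ext (by omega) h3)))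
  · refine Set.disjoint_left.2 ?_
    rintro k ⟨-, -, h1⟩ ⟨-, -, h2⟩
    exact hij (Fin.ext (h1.symm.trans h2))
  · obtain ⟨⟨h1, h2⟩, h3, -⟩ := hfT k hk
    exact ⟨(f k).1 + 1, by omega, by omega, ⟨(f k).2.1, h3⟩, hk, rfl, rfl⟩
  · rintro ⟨ℓ, -, -, j, hk, -⟩
    exact hk

section

variable {n : ℕ → ℕ} {act : ℕ → Activation} {K : ℕ} {x : Fin K → EuclideanSpace ℝ (Fin (n 1))}

/-- Covers constant labels, in particular `K ≤ 1`, where `log K ≤ 0` and no deep connections are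
guaranteed. -/
theorem realizes_const {T : Set (Fin K)} (hT : T = ∅ ∨ T = Set.univ) {L : ℕ} (hL : 2 ≤ L)
    (hn : ∀ i ∈ Finset.Icc 1 L, 0 < n i) : Realizes n act x L fun _ : Unit ↦ T := by
  induction L, hL using Nat.le_induction with
  | base =>
    have h2 : Fintype.card Unit ≤ n 2 := hn 2 (by simp)
    rcases hT with rfl | rfl
    · simpa using realizes_two (act := act) (x := x) h2 (fun _ ↦ 0) (fun _ ↦ 0)
    · simpa using realizes_two (act := act) (x := x) h2 (fun _ ↦ 0) (fun _ ↦ -1)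
  | succ ℓ hℓ ih =>
    refine (ih fun i hi ↦ hn i ?_).succ (hn (ℓ + 1) (by simp)) fun _ ↦ ?_
    · simp only [Finset.mem_Icc] at hi ⊢
      omega
    · rcases hT with rfl | rfl
      · exact IsGate.empty _
      · exact IsGate.univ _

theorem Realizes.exists_of_codes {m L : ℕ} (hL : 4 ≤ L) {A : Fin m → Set (Fin K)}
    (hA : Realizes n act x 2 A) {q : ℕ → ℕ} (hq : ∀ ℓ, 3 ≤ ℓ → ℓ ≤ L → m + 1 + q ℓ + q ℓ ≤ n ℓ)
    {P b : (ℓ : ℕ) → Fin (q ℓ) → Set (Fin K)} (hP3 : ∀ j, P 3 j = ∅)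
    (hb : ∀ ℓ, 3 ≤ ℓ → ℓ < L → ∀ i, IsGate A (b ℓ i))
    (hP : ∀ ℓ, 3 ≤ ℓ → ℓ < L → ∀ j, IsGate (b ℓ) (P (ℓ + 1) j)) :
    ∃ F ∈ networkClass n act L, ∀ k, (∀ i, 0 ≤ F (x k) i) ∧
      (F (x k) = 0 ↔ ¬ ∃ ℓ, 3 ≤ ℓ ∧ ℓ ≤ L ∧ ∃ j, k ∈ P ℓ j) := by
  set D : ℕ → Set (Fin K) := fun ℓ ↦ {k | ∃ ℓ', 3 ≤ ℓ' ∧ ℓ' < ℓ ∧ ∃ j, k ∈ P ℓ' j} with hD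
  -- A layer holds a copy of the half-space code, the accumulator of strictly earlier groups, the
  -- groups decoded here, and the NORs from which the next layer decodes its own groups.
  set B : (ℓ : ℕ) → Fin m ⊕ Unit ⊕ Fin (q ℓ) ⊕ Fin (q ℓ) → Set (Fin K) :=
    fun ℓ ↦ Sum.elim A (Sum.elim (fun _ ↦ D ℓ) (Sum.elim (P ℓ) (b ℓ))) with hB
  have hDgate (ℓ) (hℓ : 3 ≤ ℓ) : IsGate (B ℓ) (D (ℓ + 1)) := by
    refine ⟨{.inr (.inl ())} ∪ Set.range fun j ↦ .inr (.inr (.inl j)), Or.inl ?_⟩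
    ext k
    rw [Set.biUnion_union, Set.biUnion_singleton, Set.biUnion_range]
    simp only [hD, hB, Set.mem_ofPred_eq, Set.mem_union, Set.mem_iUnion, Sum.elim_inr,
      Sum.elim_inl]
    constructor
    · rintro ⟨ℓ', h3, hlt, hj⟩
      rcases (Nat.lt_succ_iff.1 hlt).lt_or_eq with h | rfl
      · exact Or.inl ⟨ℓ', h3, h, hj⟩
      · exact Or.inr hj
    · rintro (⟨ℓ', h3, hlt, hj⟩ | hj)
      · exact ⟨ℓ', h3, by omega, hj⟩
      · exact ⟨ℓ, hℓ, by omega, hj⟩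
  have hPgate (ℓ) (hℓ : 3 ≤ ℓ) (hℓL : ℓ < L) (j) : IsGate (B ℓ) (P (ℓ + 1) j) :=
    (hP ℓ hℓ hℓL j).comp (fun i ↦ .inr (.inr (.inr i))) fun i ↦ rfl
  have hcardB (ℓ) (hℓ : 3 ≤ ℓ) (hℓL : ℓ ≤ L) :
      Fintype.card (Fin m ⊕ Unit ⊕ Fin (q ℓ) ⊕ Fin (q ℓ)) ≤ n ℓ := by
    have := hq ℓ hℓ hℓL
    simp only [Fintype.card_sum, Fintype.card_fin, Fintype.card_unit]
    omega
  have hmain : ∀ ℓ, 3 ≤ ℓ → ℓ < L → Realizes n act x ℓ (B ℓ) := by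
    intro ℓ hℓ
    induction ℓ, hℓ using Nat.le_induction with
    | base =>
      intro h3
      refine hA.succ (hcardB 3 le_rfl h3.le) ?_
      rintro (a | a | a | a)
      · exact IsGate.self A a
      · have : D 3 = ∅ := by
          ext k
          simp only [hD, Set.mem_ofPred_eq, Set.mem_empty_iff_false, iff_false]
          rintro ⟨ℓ, h1, h2, -⟩
          omega
        simpa only [hB, Sum.elim_inl, Sum.elim_inr, this] using IsGate.empty A
      · simpa only [hB, Sum.elim_inl, Sum.elim_inr, hP3] using IsGate.empty A
      · exact hb 3 le_rfl h3 a
    | succ ℓ hℓ ih =>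
      intro hlt
      refine (ih (by omega)).succ (hcardB (ℓ + 1) (by omega) hlt.le) ?_
      rintro (a | a | a | a)
      · exact IsGate.self (B ℓ) (.inl a)
      · exact hDgate ℓ hℓ
      · exact hPgate ℓ hℓ (by omega) a
      · exact (hb (ℓ + 1) (by omega) hlt a).comp .inl fun i ↦ rfl
  obtain ⟨M, rfl⟩ : ∃ M, L = M + 1 := ⟨L - 1, by omega⟩
  have hlast : Realizes n act x (M + 1) (Sum.elim (fun _ : Unit ↦ D (M + 1)) (P (M + 1))) := by
    refine (hmain M (by omega) (by omega)).succ ?_ ?_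
    · have := hq (M + 1) (by omega) le_rfl
      simp only [Fintype.card_sum, Fintype.card_fin, Fintype.card_unit]
      omega
    · rintro (a | a)
      · exact hDgate M (by omega)
      · exact hPgate M (by omega) (by omega) a
  obtain ⟨F, hF, hFk⟩ := hlast.exists_mem_networkClass
  refine ⟨F, hF, fun k ↦ ⟨(hFk k).1, (hFk k).2.trans ?_⟩⟩
  rw [← not_exists_not, not_iff_not]
  simp only [not_not, Sum.exists, Sum.elim_inl, Sum.elim_inr, hD, Set.mem_ofPred_eq,
    exists_const]
  constructor
  · rintro (⟨ℓ, h1, h2, h3⟩ | h)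
    · exact ⟨ℓ, h1, by omega, h3⟩
    · exact ⟨M + 1, by omega, le_rfl, h⟩
  · rintro ⟨ℓ, h1, h2, h3⟩
    rcases h2.lt_or_eq with h | rfl
    · exact Or.inl ⟨ℓ, h1, h, h3⟩
    · exact Or.inr h3

end

/-! ### Choice of parameters and conclusion -/

theorem gaussianTail_sqrt_log_bounds {Z : ℝ} (hZ : Real.exp 8 ≤ Z) :
    gaussianTail √(2 * Real.log Z) ≤ Z⁻¹ ∧ (Z ^ 2)⁻¹ ≤ gaussianTail √(2 * Real.log Z) := by
  have hZ0 : 0 < Z := (Real.exp_pos _).trans_le hZ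
  have hlog : 8 ≤ Real.log Z := (Real.le_log_iff_exp_le hZ0).2 hZ
  set t := √(2 * Real.log Z)
  have ht : t ^ 2 = 2 * Real.log Z := Real.sq_sqrt (by linarith)
  have ht0 : 0 ≤ t := Real.sqrt_nonneg _
  constructor
  · refine (gaussianTail_le t ht0).trans_eq ?_
    rw [ht, mul_div_cancel_left₀ _ two_ne_zero, Real.exp_neg, Real.exp_log hZ0]
  · refine le_trans ?_ (le_gaussianTail ht0)
    have h4 : 4 ≤ t := by
      rw [Real.le_sqrt' (by norm_num)]
      linarith
    have h3 : (3 : ℝ) ≤ Real.exp 2 := by linarith [Real.add_one_le_exp (2 : ℝ)]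
    calc (Z ^ 2)⁻¹ = Real.exp (-(2 * Real.log Z)) := by
          rw [Real.exp_neg, two_mul, Real.exp_add, Real.exp_log hZ0, sq]
      _ ≤ Real.exp (-((t + 1) ^ 2 / 2)) / Real.exp 2 := by
          rw [← Real.exp_sub, Real.exp_le_exp]
          nlinarith
      _ ≤ _ := by gcongr

theorem exists_code_of_separated {E : Type*} [NormedAddCommGroup E] [InnerProductSpace ℝ E]
    [FiniteDimensional ℝ E] [MeasurableSpace E] [BorelSpace E] {K m : ℕ} (hK : 2 ≤ K)
    (x : Fin K → E) (hx : ∀ k, ‖x k‖ = 1) {Z Λ : ℝ} (hZ : Real.exp 8 ≤ Z) (hm : Z ^ 5 / 8 ≤ m)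
    (hΛ : 4 ≤ Λ) (hΛZ : Λ ≤ Z / 6) (hKZ : Real.log K ≤ Z / 6)
    (hsep : ∀ j k, j ≠ k → 8 * (Real.log Λ / Real.log Z) ≤ ‖x j - x k‖ ^ 2) :
    ∃ (α t : ℝ) (g : Fin m → E), 0 < α ∧ α ≤ 1 / 4 ∧
      (∀ k, |({l | t < inner ℝ (x k) (g l)}.ncard : ℝ) - α * m| ≤ Λ⁻¹ * (α * m)) ∧
      ∀ j k, j ≠ k → ({l | t < inner ℝ (x j) (g l) ∧ t < inner ℝ (x k) (g l)}.ncard : ℝ) ≤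
        Λ⁻¹ * (α * m) := by
  have hZ0 : 0 < Z := (Real.exp_pos _).trans_le hZ
  have hΛ0 : 0 < Λ := by linarith
  have hlog : 8 ≤ Real.log Z := (Real.le_log_iff_exp_le hZ0).2 hZ
  obtain ⟨hα1, hα2⟩ := gaussianTail_sqrt_log_bounds hZ
  have ht : √(2 * Real.log Z) ^ 2 = 2 * Real.log Z := Real.sq_sqrt (by linarith)
  set t := √(2 * Real.log Z)
  set α := gaussianTail t
  have hα0 : 0 < α := lt_of_lt_of_le (by positivity) hα2
  have hα4 : α ≤ 1 / 4 := by
    refine hα1.trans ?_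
    rw [one_div]
    gcongr
    linarith
  have hpair (j k) (hjk : j ≠ k) :
      Real.exp (-(t ^ 2 * ‖x j - x k‖ ^ 2 / 8)) ≤ Λ⁻¹ / 4 := by
    have h1 := mul_le_mul_of_nonneg_left (hsep j k hjk) (by linarith : 0 ≤ Real.log Z)
    have h2 : Real.log Z * (8 * (Real.log Λ / Real.log Z)) = 8 * Real.log Λ := by
      field_simp
    rw [h2] at h1
    calc _ ≤ Real.exp (-(Real.log Λ + Real.log Λ)) := by
          rw [Real.exp_le_exp, ht]
          linarith
      _ = Λ⁻¹ * Λ⁻¹ := by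
          rw [Real.exp_neg, Real.exp_add, Real.exp_log hΛ0, mul_inv]
      _ ≤ Λ⁻¹ * 4⁻¹ := by gcongr
      _ = _ := by ring
  -- The fifth root is spent here: `α` costs `Z²`, the accuracy `Λ⁻¹` costs another `Z²`, and the
  -- last factor `Z` must beat `log K`.
  have hlarge : 12 * Real.log K < α * m * Λ⁻¹ ^ 2 := by
    calc 12 * Real.log K ≤ 2 * Z := by linarith
      _ < 9 / 2 * Z := by linarith
      _ = (Z ^ 2)⁻¹ * (Z ^ 5 / 8) * (Z / 6)⁻¹ ^ 2 := by
          field_simp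
          norm_num
      _ ≤ α * m * Λ⁻¹ ^ 2 := by gcongr
  obtain ⟨g, hg1, hg2⟩ := exists_halfspace_code hK x hx (Real.sqrt_nonneg _) (inv_pos.2 hΛ0)
    (inv_le_one_of_one_le₀ (by linarith)) hpair hlarge
  exact ⟨α, t, g, hα0, hα4, hg1, hg2⟩

theorem exists_network_of_separated {n : ℕ → ℕ} {act : ℕ → Activation} {K L : ℕ} (hK : 2 ≤ K)
    {x : Fin K → EuclideanSpace ℝ (Fin (n 1))} (hx : ∀ k, ‖x k‖ = 1) {n₀ : ℕ} {Z Λ : ℝ}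
    (hZ : 600 * Real.exp 20 ≤ Z) (hn₀ : (n₀ : ℝ) = Z ^ 5) (hmin : ∀ ℓ, 2 ≤ ℓ → ℓ ≤ L → n₀ ≤ n ℓ)
    (hmax : ∀ ℓ, 2 ≤ ℓ → ℓ ≤ L → Real.log (n ℓ) ≤ Λ)
    (hΛ : 4 ≤ Λ) (hΛZ : Λ ≤ Z / 6) (hKZ : Real.log K ≤ Z / 6)
    (hsep : ∀ j k, j ≠ k → 8 * (Real.log Λ / Real.log Z) ≤ ‖x j - x k‖ ^ 2)
    {Y : Set (Fin K)} (hY : Y.Nonempty)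
    (hW : 6144 * Real.exp 20 * Real.log K * Y.ncard ≤ (deepConnections n L : ℝ)) :
    ∃ F ∈ networkClass n act L, ∀ k, (∀ i, 0 ≤ F (x k) i) ∧ (F (x k) = 0 ↔ k ∉ Y) := by
  have hlogK : 0 < Real.log K := Real.log_pos (by exact_mod_cast hK)
  have he : (1 : ℝ) ≤ Real.exp 20 := Real.one_le_exp (by norm_num)
  have hZ1 : 600 ≤ Z := by linarith
  have hΛ0 : 0 < Λ := by linarith
  have hY0 : 0 < Y.ncard := (Set.ncard_pos (Set.toFinite _)).2 hY
  have hL : 4 ≤ L := by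
    by_contra h
    have h0 : deepConnections n L = 0 := by
      rw [deepConnections, Finset.Ico_eq_empty (by omega), Finset.sum_empty]
    rw [h0] at hW
    have : 0 < 6144 * Real.exp 20 * Real.log K * Y.ncard := by positivity
    norm_num at hW
    linarith
  have hZ5 : 8 * (300 * Real.exp 20) * Z ≤ Z ^ 5 := by
    calc 8 * (300 * Real.exp 20) * Z ≤ 8 * Z * Z := by gcongr; linarith
      _ ≤ Z ^ 3 * Z * Z := by
          gcongr
          calc (8 : ℝ) = 2 ^ 3 := by norm_num
            _ ≤ Z ^ 3 := by gcongr; linarith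
      _ = Z ^ 5 := by ring
  have hn₀Z : 8 * (300 * Real.exp 20) * Z ≤ n₀ := hn₀ ▸ hZ5
  have hn₀8 : 8 ≤ n₀ := by
    have : (8 : ℝ) ≤ n₀ := by nlinarith
    exact_mod_cast this
  have hdiv (a : ℕ) (ha : n₀ ≤ a) : (a : ℝ) / 8 ≤ ((a / 4 : ℕ) : ℝ) := by
    rw [div_le_iff₀ (by norm_num)]
    norm_cast
    omega
  have hqlarge (ℓ) (h2 : 2 ≤ ℓ) (hℓ : ℓ ≤ L) : 300 * Real.exp 20 * Z ≤ ((n ℓ / 4 : ℕ) : ℝ) := by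
    have h1 : (n₀ : ℝ) ≤ n ℓ := by exact_mod_cast hmin ℓ h2 hℓ
    linarith [hdiv _ (hmin ℓ h2 hℓ)]
  -- The largest group size that `n ℓ / 4` NORs can store; the quarters leave room for the four
  -- blocks of a layer.
  set s : ℕ → ℕ := fun ℓ ↦ ⌊((n ℓ / 4 : ℕ) : ℝ) / (48 * Real.exp 20 * Real.log K)⌋₊ with hs
  have hs1 (ℓ) : 48 * Real.exp 20 * Real.log K * s ℓ ≤ ((n ℓ / 4 : ℕ) : ℝ) := by
    rw [mul_comm, ← le_div_iff₀ (by positivity)]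
    exact Nat.floor_le (by positivity)
  have hs2 (ℓ) (h2 : 2 ≤ ℓ) (hℓ : ℓ ≤ L) :
      (n ℓ : ℝ) / (768 * Real.exp 20 * Real.log K) ≤ s ℓ := by
    set z := ((n ℓ / 4 : ℕ) : ℝ) / (48 * Real.exp 20 * Real.log K)
    have h1 : 1 ≤ z := by
      rw [le_div_iff₀ (by positivity)]
      calc 1 * (48 * Real.exp 20 * Real.log K) ≤ 1 * (48 * Real.exp 20 * (Z / 6)) := by gcongr
        _ ≤ 300 * Real.exp 20 * Z := by nlinarith
        _ ≤ _ := hqlarge ℓ h2 hℓ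
    have h3 : (n ℓ : ℝ) / (768 * Real.exp 20 * Real.log K) ≤ z / 2 := by
      calc _ = ((n ℓ : ℝ) / 8) / (48 * Real.exp 20 * Real.log K) / 2 := by
            field_simp
            ring
        _ ≤ _ := div_le_div_of_nonneg_right
            (div_le_div_of_nonneg_right (hdiv _ (hmin ℓ h2 hℓ)) (by positivity)) two_pos.le
    have h4 : z < s ℓ + 1 := Nat.lt_floor_add_one z
    have h5 : (1 : ℝ) ≤ s ℓ := by
      have : 1 ≤ s ℓ := (Nat.one_le_floor_iff z).2 h1
      exact_mod_cast this
    linarith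
  have hcap : Y.ncard ≤ ∑ ℓ ∈ Finset.Ico 3 L, (fun ℓ ↦ n ℓ / 4) (ℓ + 1) * s ℓ := by
    have h1 : (deepConnections n L : ℝ) ≤
        6144 * Real.exp 20 * Real.log K *
          ((∑ ℓ ∈ Finset.Ico 3 L, n (ℓ + 1) / 4 * s ℓ : ℕ) : ℝ) := by
      rw [deepConnections]
      push_cast only [Nat.cast_sum, Nat.cast_mul]
      rw [Finset.mul_sum]
      refine Finset.sum_le_sum fun ℓ hℓ ↦ ?_
      rw [Finset.mem_Ico] at hℓ
      have h2 := hs2 ℓ (by omega) (by omega)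
      have h3 := hdiv _ (hmin (ℓ + 1) (by omega) (by omega))
      calc (n ℓ : ℝ) * n (ℓ + 1) = 6144 * Real.exp 20 * Real.log K *
            ((n (ℓ + 1) : ℝ) / 8 * (n ℓ / (768 * Real.exp 20 * Real.log K))) := by
            field_simp
            ring
        _ ≤ _ := by gcongr
    have h2 := le_of_mul_le_mul_left (hW.trans h1) (by positivity)
    exact_mod_cast h2
  obtain ⟨P, hP3, hPs, hPd, hPY⟩ := exists_groups Y L (fun ℓ ↦ n ℓ / 4) s hcap
  have h8 : Real.exp 8 ≤ Z := by
    have : Real.exp 8 ≤ Real.exp 20 := Real.exp_le_exp.2 (by norm_num)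
    linarith
  obtain ⟨α, t, g, hα, hα4, hcount, hpair⟩ := exists_code_of_separated (m := n₀ / 4) hK x hx h8
    (by rw [← hn₀]; exact hdiv n₀ le_rfl) hΛ hΛZ hKZ hsep
  set A : Fin (n₀ / 4) → Set (Fin K) := fun l ↦ {k | t < inner ℝ (x k) (g l)} with hA
  have hAr : Realizes n act x 2 A := by
    refine realizes_two ?_ g fun _ ↦ t
    have := hmin 2 le_rfl (by omega)
    rw [Fintype.card_fin]
    omega
  have hcode (ℓ) : ∃ b : Fin (n ℓ / 4) → Set (Fin K), 3 ≤ ℓ → ℓ < L →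
      (∀ i, IsGate A (b i)) ∧ ∀ j, IsGate b (P (ℓ + 1) j) := by
    by_cases hℓ : 3 ≤ ℓ ∧ ℓ < L
    · have hql := hqlarge ℓ (by omega) (by omega)
      obtain ⟨b, hb⟩ := exists_nor_code_of_disjoint hK (by omega) A hα hα4 (inv_pos.2 hΛ0)
        (inv_le_one_of_one_le₀ (by linarith)) hcount hpair (N := n ℓ / 4)
        (by nlinarith) (by
          rw [inv_mul_le_iff₀ hΛ0, mul_one]
          refine le_trans (Real.log_le_log (by nlinarith) ?_) (hmax ℓ (by omega) (by omega))
          exact_mod_cast Nat.div_le_self _ _) (P (ℓ + 1)) (hPd (ℓ + 1)) fun j ↦ by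
          refine le_trans ?_ (hs1 ℓ)
          gcongr
          exact hPs ℓ j
      exact ⟨b, fun _ _ ↦ hb⟩
    · exact ⟨fun _ ↦ ∅, fun h1 h2 ↦ absurd ⟨h1, h2⟩ hℓ⟩
  choose b hb using hcode
  obtain ⟨F, hF, hFk⟩ := hAr.exists_of_codes hL (q := fun ℓ ↦ n ℓ / 4) (fun ℓ h3 hℓ ↦ by
      have := hmin ℓ (by omega) hℓ
      omega) hP3
    (fun ℓ h3 hℓ ↦ (hb ℓ h3 hℓ).1) (fun ℓ h3 hℓ ↦ (hb ℓ h3 hℓ).2)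
  exact ⟨F, hF, fun k ↦ ⟨(hFk k).1, (hFk k).2.trans (not_congr (hPY k).symm)⟩⟩

theorem exists_network_zero_iff {L : ℕ} (hL : 2 ≤ L) {n : ℕ → ℕ} (hn : ∀ i ∈ Finset.Icc 1 L, 0 < n i)
    (act : ℕ → Activation) {K : ℕ} {x : Fin K → EuclideanSpace ℝ (Fin (n 1))}
    (hx : ∀ k, ‖x k‖ = 1)
    (hsep : ∀ i j, i ≠ j → 100000 * Real.exp 20 *
      √(Real.log (Real.log (maxWidth n L hL : ℝ)) / Real.log (minWidth n L hL : ℝ)) ≤ ‖x i - x j‖)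
    (hK : (K : ℝ) ≤ Real.exp (Real.exp (-20) / 1000 * (minWidth n L hL : ℝ) ^ (1 / 5 : ℝ)))
    (hmax : (maxWidth n L hL : ℝ) ≤
      Real.exp (Real.exp (-20) / 1000 * (minWidth n L hL : ℝ) ^ (1 / 5 : ℝ)))
    {Y : Set (Fin K)} {K₁ : ℕ} (hYK : Y.ncard ≤ K₁)
    (hW : 100000 * Real.exp 20 * K₁ * Real.log K ^ 5 ≤ (deepConnections n L : ℝ)) :
    ∃ F ∈ networkClass n act L, ∀ k, (∀ i, 0 ≤ F (x k) i) ∧ (F (x k) = 0 ↔ k ∉ Y) := by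
  by_cases hY : Y = ∅ ∨ Y = Set.univ
  · obtain ⟨F, hF, hFk⟩ := (realizes_const (act := act) (x := x) hY hL hn).exists_mem_networkClass
    exact ⟨F, hF, fun k ↦ ⟨(hFk k).1, by rw [(hFk k).2]; simp⟩⟩
  push Not at hY
  obtain ⟨hne, huniv⟩ := hY
  have hK2 : 2 ≤ K := by
    by_contra h
    obtain ⟨a, ha⟩ := hne
    obtain ⟨b, hb⟩ := (Set.ne_univ_iff_exists_notMem Y).1 huniv
    exact hb (by rwa [show b = a from Fin.ext (by omega)])
  have hmin (ℓ) (h2 : 2 ≤ ℓ) (hℓ : ℓ ≤ L) : minWidth n L hL ≤ n ℓ :=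
    Finset.inf'_le n (Finset.mem_Icc.2 ⟨h2, hℓ⟩)
  have hmax' (ℓ) (h2 : 2 ≤ ℓ) (hℓ : ℓ ≤ L) : n ℓ ≤ maxWidth n L hL :=
    Finset.le_sup' n (Finset.mem_Icc.2 ⟨h2, hℓ⟩)
  have hpos : 0 < minWidth n L hL := by
    refine (Finset.lt_inf'_iff _).2 fun i hi ↦ hn i ?_
    rw [Finset.mem_Icc] at hi ⊢
    omega
  set a := minWidth n L hL
  set w := maxWidth n L hL
  have haw : a ≤ w := (hmin 2 le_rfl hL).trans (hmax' 2 le_rfl hL)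
  set Z : ℝ := (a : ℝ) ^ (1 / 5 : ℝ) with hZdef
  have ha0 : (0 : ℝ) < a := by exact_mod_cast hpos
  have hZ5 : (a : ℝ) = Z ^ 5 := by
    rw [hZdef, ← Real.rpow_natCast, ← Real.rpow_mul ha0.le]
    norm_num
  have hZ0 : 0 < Z := Real.rpow_pos_of_pos ha0 _
  have hE : Real.exp (-20) * Real.exp 20 = 1 := by rw [← Real.exp_add]; simp
  have he1 : Real.exp (-20) ≤ 1 := Real.exp_le_one_iff.2 (by norm_num)
  have he20 : 1 ≤ Real.exp 20 := Real.one_le_exp (by norm_num)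
  have hc : Real.exp (-20) / 1000 * Z ≤ Z / 6 := by
    have := mul_le_mul_of_nonneg_right he1 hZ0.le
    linarith
  have hK0 : (0 : ℝ) < K := by positivity
  have hw0 : (0 : ℝ) < w := by exact_mod_cast hpos.trans_le haw
  have hlogK := (Real.log_le_iff_le_exp hK0).2 hK
  have hlogw := (Real.log_le_iff_le_exp hw0).2 hmax
  have hlog2 : 0.6931471803 < Real.log K :=
    Real.log_two_gt_d9.trans_le (Real.log_le_log (by norm_num) (by exact_mod_cast hK2))
  -- Largeness of `n₀` comes for free: `log 2 ≤ log K ≤ cZ` with `c = e⁻²⁰ / 1000`.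
  have hZ : 600 * Real.exp 20 ≤ Z := by
    have h1 : Real.exp 20 * (Real.exp (-20) / 1000 * Z) = Z / 1000 := by
      linear_combination (Z / 1000) * hE
    have h2 := mul_le_mul_of_nonneg_left (hlog2.le.trans hlogK) (Real.exp_pos 20).le
    linarith
  have hloga : Real.log a = 5 * Real.log Z := by
    rw [hZ5, Real.log_pow]
    norm_num
  have hlogZ : 20 ≤ Real.log Z := by
    rw [Real.le_log_iff_exp_le hZ0]
    linarith
  have hΛ : Real.log a ≤ Real.log w := Real.log_le_log ha0 (by exact_mod_cast haw)
  refine exists_network_of_separated hK2 hx hZ hZ5 hmin (fun ℓ h2 hℓ ↦ ?_)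
    (by linarith : 4 ≤ Real.log w) (hlogw.trans hc) (hlogK.trans hc) (fun i j hij ↦ ?_) hne ?_
  · refine Real.log_le_log ?_ (by exact_mod_cast hmax' ℓ h2 hℓ)
    exact_mod_cast hpos.trans_le (hmin ℓ h2 hℓ)
  · have h0 : 0 ≤ Real.log (Real.log w) := Real.log_nonneg (by linarith)
    have h1 := pow_le_pow_left₀ (by positivity) (hsep i j hij) 2
    rw [mul_pow, Real.sq_sqrt (by rw [hloga]; positivity), hloga] at h1
    refine le_trans ?_ h1
    have h2 : Real.log (Real.log w) / (5 * Real.log Z) =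
        (Real.log (Real.log w) / Real.log Z) / 5 := by
      field_simp
    have h3 : 0 ≤ Real.log (Real.log w) / Real.log Z := by positivity
    have h4 : (100 : ℝ) ^ 2 ≤ (100000 * Real.exp 20) ^ 2 := by
      gcongr
      linarith
    rw [h2]
    nlinarith
  · have h1 : (Y.ncard : ℝ) ≤ K₁ := by exact_mod_cast hYK
    -- The construction needs only one factor `log K`; the other four are slack, bounded below by a
    -- constant since `K ≥ 2`.
    have h2 : (1 / 2) ^ 4 ≤ Real.log K ^ 4 := by
      gcongr
      linarith
    calc 6144 * Real.exp 20 * Real.log K * Y.ncard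
        ≤ 6144 * Real.exp 20 * Real.log K * K₁ := by gcongr
      _ = 98304 * Real.exp 20 * K₁ * Real.log K * (1 / 2) ^ 4 := by ring
      _ ≤ 100000 * Real.exp 20 * K₁ * Real.log K * Real.log K ^ 4 := by
          gcongr
          norm_num
      _ = 100000 * Real.exp 20 * K₁ * Real.log K ^ 5 := by ring
      _ ≤ _ := hW

theorem theorem6p2 :
    ∃ C c : ℝ, 0 < C ∧ 0 < c ∧
      ∀ (L : ℕ) (hL : 2 ≤ L) (n : ℕ → ℕ), (∀ i ∈ Finset.Icc 1 L, 0 < n i) →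
      ∀ (act : ℕ → Activation) (K : ℕ) (x : Fin K → EuclideanSpace ℝ (Fin (n 1))),
        (∀ k, ‖x k‖ = 1) →
        (∀ i j, i ≠ j →
          C * √(Real.log (Real.log (maxWidth n L hL : ℝ)) / Real.log (minWidth n L hL : ℝ)) ≤
            ‖x i - x j‖) →
        (K : ℝ) ≤ Real.exp (c * (minWidth n L hL : ℝ) ^ (1 / 5 : ℝ)) →
        (maxWidth n L hL : ℝ) ≤ Real.exp (c * (minWidth n L hL : ℝ) ^ (1 / 5 : ℝ)) →
      ∀ y : Fin K → ℝ, (∀ k, y k = 0 ∨ y k = 1) →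
        (∀ K₁ : ℕ, {k | y k = 1}.ncard ≤ K₁ →
          C * K₁ * Real.log K ^ 5 ≤ (deepConnections n L : ℝ) →
          ∃ F ∈ networkClass n act L, ∀ k, F (x k) = 0 ↔ y k = 0) ∧
        (C * K * Real.log K ^ 5 ≤ (deepConnections n L : ℝ) →
          ∃ F ∈ singleOutputClass n act L, ∀ k, F (x k) = y k) := by
  refine ⟨100000 * Real.exp 20, Real.exp (-20) / 1000, by positivity, by positivity, ?_⟩
  intro L hL n hn act K x hx hsep hK hmax y hy
  have key : ∀ K₁ : ℕ, {k | y k = 1}.ncard ≤ K₁ →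
      100000 * Real.exp 20 * K₁ * Real.log K ^ 5 ≤ (deepConnections n L : ℝ) →
      ∃ F ∈ networkClass n act L, ∀ k, (∀ i, 0 ≤ F (x k) i) ∧ (F (x k) = 0 ↔ y k = 0) := by
    intro K₁ hK₁ hW
    obtain ⟨F, hF, hFk⟩ := exists_network_zero_iff hL hn act hx hsep hK hmax hK₁ hW
    refine ⟨F, hF, fun k ↦ ⟨(hFk k).1, (hFk k).2.trans ?_⟩⟩
    rcases hy k with h | h <;> simp [h]
  refine ⟨fun K₁ hK₁ hW ↦ ?_, fun hW ↦ ?_⟩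
  · obtain ⟨F, hF, hFk⟩ := key K₁ hK₁ hW
    exact ⟨F, hF, fun k ↦ (hFk k).2⟩
  · obtain ⟨F, hF, hFk⟩ := key K ((Set.ncard_le_card _).trans_eq (by simp)) hW
    exact exists_mem_singleOutputClass hy hF (fun k ↦ (hFk k).1) fun k ↦ (hFk k).2
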